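/- Let $A\in\mathbb R^{n\times n}$ be symmetric positive semidefinite, $b\in\mathbb R^n$, $\tau\ge 0$, and $F(x)=f(x)+\tau\|x\|_1$ with $f(x)=\tfrac12x^TAx-b^Tx$. Assume that $F$ has a minimizer; let $\mathcal S^*$ be the set of its minimizers. **Notation.** $I_0(x),I_+(x),I_-(x)$ are the sets of indices $i$ with $x_i=0$, $x_i>0$, $x_i<0$, and $I_0^c(x)$ is the complement of $I_0(x)$. The minimum-norm subgradient is $v_i(x)=\nabla_if(x)+\tau\,\mathrm{sgn}(x_i)$ if $x_i\ne0$ and $v_i(x)=\min(\nabla_if(x)+\tau,\max(0,\nabla_if(x)-\tau))$ if $x_i=0$. The vector $v^P(x)$ has components $v_i(x)$ for $i\in I_0(x)$ and $0$ otherwise. $I_0^0(x),I_0^+(x),I_0^-(x)$ are the sets of $i\in I_0(x)$ with $|\nabla_if(x)|\le\tau$, $\nabla_if(x)<-\tau$, $\nabla_if(x)>\tau$, respectively. $c_i(x;\tau)$ is $\tau$ on $I_+(x)\cup I_0^+(x)$, $-\tau$ on $I_-(x)\cup I_0^-(x)$, and $0$ on $I_0^0(x)$. $\mathcal H(x)=\{y: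 y_i=0,\ i\in I_0(x)\}$, $F^*_x=\min_{\mathcal H(x)}F$, and $\mathcal P_S$ is the orthogonal projection onto $S$. $\|\cdot\|$ is the Euclidean norm of vectors and the spectral norm of matrices. Finally $\mathcal I^*=\{J\subseteq I_0(x^*):x^*\in\mathcal S^*\}$, and $L(n)$ is one plus the largest number of distinct subsets of $\{1,\dots,n\}$ not belonging to $\mathcal I^*$. **TPCG1**$(A,b,c,J_0,J_-,J_+,x^0,\varepsilon)$. Let $\Omega=\{x: x_j=0\ (j\in J_0),\ x_j\le0\ (j\in J_-),\ x_j\ge0\ (j\in J_+)\}$, $\mathcal H=\{x:x_j=0,\ j\in J_0\}$, $r^0=Ax^0-b+c$, $p^0=\mathcal P_{\mathcal H}(r^0)$, $d^0=-p^0$. For $k=0,1,\dots$: put $\alpha^{cg}_k=\|p^k\|^2/((d^k)^TAd^k)$ ($=\infty$ if the denominator is $0$), $\alpha^{tc}_k=\max\{\alpha:x^k+\alpha d^k\in\Omega\}$ ($=\infty$ if unbounded), $\alpha_k=\min\{\alpha^{cg}_k,\alpha^{tc}_k\}$ and $x^{k+1}=x^k+\alpha_kd^k$. If $\alpha_k^{cg}>\alpha_k$,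 return $x^{k+1}$. Otherwise put $r^{k+1}=r^k+\alpha_kAd^k$, $p^{k+1}=\mathcal P_{\mathcal H}(r^{k+1})$; if $\|p^{k+1}\|_\infty\le\varepsilon$, return $x^{k+1}$; otherwise put $d^{k+1}=-p^{k+1}+\frac{\|p^{k+1}\|^2}{\|p^k\|^2}d^k$ and continue. **TPCG2**$(A,b,c,J_0,J_-,J_+,x^0,\varepsilon)$. Put $(J_0^0,J_-^0,J_+^0)=(J_0,J_-,J_+)$. For $k=0,1,\dots$: with $\mathcal H_k=\{x:x_j=0,\ j\in J_0^k\}$, if $\|\mathcal P_{\mathcal H_k}(Ax^k-b+c)\|_\infty\le\varepsilon$, return $x^k$; otherwise put $x^{k+1}=\mathrm{TPCG1}(A,b,c,J^k_0,J^k_-,J^k_+,x^k,\varepsilon)$ and $(J_0^{k+1},J_-^{k+1},J_+^{k+1})=(I_0,I_-,I_+)(x^{k+1})$. **GCG method 2** with input $x^0\in\mathbb R^n$, $\eta>0$, $\varepsilon\ge0$. For $k=0,1,\dots$: if $\|v(x^k)\|_\infty\le\varepsilon$, return $y=x^k$. Otherwise, if $\|[v(x^k)]_{I_0(x^k)}\|>\sqrt\eta\,\|[v(x^k)]_{I^c_0(x^k)}\|$,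 put $x^{k+1}=x^k-\alpha_kv^P(x^k)$ with $\alpha_k=\frac{\|v^P(x^k)\|^2}{v^P(x^k)^TAv^P(x^k)}$; else put $$x^{k+1}=\mathrm{TPCG2}\Big(A,b,c(x^k;\tau),I_0^0(x^k),I_-(x^k)\cup I_0^-(x^k),I_+(x^k)\cup I_0^+(x^k),x^k,\tfrac{\varepsilon}{\max(\sqrt{n\eta},1)}\Big).$$ **Theorem.** Suppose that $\eta>0$ satisfies the error bound $$2\|A\|\,\big(F(x)-F_x^*\big)\le\eta\,\big\|[v(x)]_{I_0^c(x)}\big\|^2\quad\text{for all }x\text{ with }F(x)\le F(x^0).$$ Then: (i) GCG method 2 is well defined (in particular every call of TPCG1 and TPCG2 that it makes terminates), and it terminates in at most $2L(n)$ iterations, the iteration in which it returns its output included. (ii) If $y$ is the output of GCG method 2, then there is $s\in\partial F(y)$ with $\|s\|_\infty\le\varepsilon$, and $y$ is a minimizer of $F$ if $\varepsilon=0$. -/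

import Mathlib

noncomputable section

namespace L1QP

/-! ### Repeat-loops with a pass counter

The body of a loop is a partial function: `Sum.inl y` means "return `y` and terminate",
`Sum.inr s` means "go on to the next pass with state `s`", and an undefined value means that the
pass cannot be carried out.  The value computed by the loop is `PFun.fix body`. -/

/-- Started in state `s`, the loop returns `y` in its `k`-th pass through the body (so `k` passes
are made altogether, the one in which it returns included). -/
def LoopReturns {σ α : Type} (body : σ →. α ⊕ σ) : ℕ → σ → α → Prop
  | 0, _, _ => False
  | k + 1, s, y =>
      Sum.inl y ∈ body s ∨ ∃ s', Sum.inr s' ∈ body s ∧ LoopReturns body k s' y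

theorem mem_fix_iff_loopReturns {σ α : Type} (body : σ →. α ⊕ σ) (s : σ) (y : α) :
    y ∈ PFun.fix body s ↔ ∃ k, LoopReturns body k s y := by
  constructor
  · intro h
    refine PFun.fixInduction' (C := fun s => ∃ k, LoopReturns body k s y) h ?_ ?_
    · intro a ha
      exact ⟨1, Or.inl ha⟩
    · rintro a₀ a₁ - h₁ ⟨k, hk⟩
      exact ⟨k + 1, Or.inr ⟨a₁, h₁, hk⟩⟩
  · rintro ⟨k, hk⟩
    induction k generalizing s with
    | zero => exact hk.elim
    | succ k ih =>
      rcases hk with h | ⟨s', h, h'⟩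
      · exact PFun.mem_fix_iff.2 (Or.inl h)
      · exact PFun.mem_fix_iff.2 (Or.inr ⟨s', h, ih s' h'⟩)

open scoped Matrix

variable {n : ℕ}

/-! ### The problem `min F`

Vectors are functions `Fin n → ℝ`.  On this type Mathlib's norm `‖x‖` is the maximum norm
`‖x‖_∞`; the squared Euclidean norm of `x` is written `x ⬝ᵥ x`. -/

/-- `F(x) = ½ xᵀAx - bᵀx + τ‖x‖₁`. -/
def F (A : Matrix (Fin n) (Fin n) ℝ) (b : Fin n → ℝ) (τ : ℝ) (x : Fin n → ℝ) : ℝ :=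
  1 / 2 * (x ⬝ᵥ A *ᵥ x) - b ⬝ᵥ x + τ * ∑ i, |x i|

/-- `x` is an optimal solution, that is, a global minimiser of `F`. -/
def IsOptimal (A : Matrix (Fin n) (Fin n) ℝ) (b : Fin n → ℝ) (τ : ℝ) (x : Fin n → ℝ) : Prop :=
  ∀ z, F A b τ x ≤ F A b τ z

/-- The subdifferential `∂F(x)` of the convex function `F`. -/
def subdiff (A : Matrix (Fin n) (Fin n) ℝ) (b : Fin n → ℝ) (τ : ℝ) (x : Fin n → ℝ) :
    Set (Fin n → ℝ) :=
  {s | ∀ z, F A b τ x + s ⬝ᵥ (z - x) ≤ F A b τ z}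

/-- The gradient `Ax - b` of `f(x) = ½ xᵀAx - bᵀx` (for symmetric `A`). -/
def grad (A : Matrix (Fin n) (Fin n) ℝ) (b x : Fin n → ℝ) : Fin n → ℝ :=
  A *ᵥ x - b

/-- The minimum-norm subgradient `v(x)` of `F` at `x`. -/
def v (A : Matrix (Fin n) (Fin n) ℝ) (b : Fin n → ℝ) (τ : ℝ) (x : Fin n → ℝ) : Fin n → ℝ :=
  fun i =>
    if x i = 0 then min (grad A b x i + τ) (max 0 (grad A b x i - τ))
    else grad A b x i + τ * Real.sign (x i)

/-- The spectral norm of `A`. -/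
def specNorm (A : Matrix (Fin n) (Fin n) ℝ) : ℝ :=
  ‖Matrix.toEuclideanCLM (n := Fin n) (𝕜 := ℝ) A‖

/-- The Euclidean norm of the subvector `u_J`. -/
def subNorm (J : Finset (Fin n)) (u : Fin n → ℝ) : ℝ :=
  √(∑ i ∈ J, u i ^ 2)

/-! ### Index sets -/

/-- `I_-(x)` -/
def INeg (x : Fin n → ℝ) : Finset (Fin n) := {i | x i < 0}

/-- `I_+(x)` -/
def IPos (x : Fin n → ℝ) : Finset (Fin n) := {i | 0 < x i}

/-- `I_0(x)` -/
def IZero (x : Fin n → ℝ) : Finset (Fin n) := {i | x i = 0}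

/-- The complement of `I_0(x)`. -/
def INonzero (x : Fin n → ℝ) : Finset (Fin n) := {i | x i ≠ 0}

/-- `I_0^0(x)` -/
def IZeroZero (A : Matrix (Fin n) (Fin n) ℝ) (b : Fin n → ℝ) (τ : ℝ) (x : Fin n → ℝ) :
    Finset (Fin n) :=
  {i | x i = 0 ∧ grad A b x i - τ ≤ 0 ∧ 0 ≤ grad A b x i + τ}

/-- `I_0^+(x)` -/
def IZeroPos (A : Matrix (Fin n) (Fin n) ℝ) (b : Fin n → ℝ) (τ : ℝ) (x : Fin n → ℝ) :
    Finset (Fin n) :=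
  {i | x i = 0 ∧ grad A b x i + τ < 0}

/-- `I_0^-(x)` -/
def IZeroNeg (A : Matrix (Fin n) (Fin n) ℝ) (b : Fin n → ℝ) (τ : ℝ) (x : Fin n → ℝ) :
    Finset (Fin n) :=
  {i | x i = 0 ∧ 0 < grad A b x i - τ}

/-- The vector `c(x; τ)`: the indices in neither of the two unions are those in `I_0^0(x)`. -/
def cvec (A : Matrix (Fin n) (Fin n) ℝ) (b : Fin n → ℝ) (τ : ℝ) (x : Fin n → ℝ) : Fin n → ℝ :=
  fun i =>
    if i ∈ IPos x ∪ IZeroPos A b τ x then τ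
    else if i ∈ INeg x ∪ IZeroNeg A b τ x then -τ
    else 0

/-- The subspace `{y : y_j = 0 for j ∈ J}`. -/
def coordSubspace (J : Finset (Fin n)) : Set (Fin n → ℝ) :=
  {y | ∀ j ∈ J, y j = 0}

/-- The orthogonal projection of `u` onto `coordSubspace J`. -/
def proj (J : Finset (Fin n)) (u : Fin n → ℝ) : Fin n → ℝ :=
  fun i => if i ∈ J then 0 else u i

/-- `v^P(x)`: the components of `v(x)` in `I_0(x)`, all other components being set to `0`. -/
def vP (A : Matrix (Fin n) (Fin n) ℝ) (b : Fin n → ℝ) (τ : ℝ) (x : Fin n → ℝ) : Fin n → ℝ :=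
  fun i => if i ∈ IZero x then v A b τ x i else 0

/-- `F^*_x`, the minimum of `F` over `{y : y_i = 0 for i ∈ I_0(x)}`. -/
def FStar (A : Matrix (Fin n) (Fin n) ℝ) (b : Fin n → ℝ) (τ : ℝ) (x : Fin n → ℝ) : ℝ :=
  sInf (F A b τ '' coordSubspace (IZero x))

/-- The error bound `F(x) - F^*_x ≤ η / (2‖A‖) ‖[v(x)]_J‖²`, `J` the complement of `I_0(x)`, on the
sublevel set of `x0`.  It is multiplied out by `2‖A‖`, so that `A = 0` needs no exception. -/
def ErrorBound (A : Matrix (Fin n) (Fin n) ℝ) (b : Fin n → ℝ) (τ : ℝ) (x0 : Fin n → ℝ)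
    (η : ℝ) : Prop :=
  ∀ x, F A b τ x ≤ F A b τ x0 →
    2 * specNorm A * (F A b τ x - FStar A b τ x) ≤ η * subNorm (INonzero x) (v A b τ x) ^ 2

/-- The family `I^*` of all `J` with `J ⊆ I_0(x*)` for some optimal solution `x*`. -/
def IStar (A : Matrix (Fin n) (Fin n) ℝ) (b : Fin n → ℝ) (τ : ℝ) : Set (Finset (Fin n)) :=
  {J | ∃ z, IsOptimal A b τ z ∧ J ⊆ IZero z}

/-- `L(n)`: one plus the largest `ℓ` for which there are `ℓ` distinct subsets of the index set
that do not belong to `I^*`. -/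
def Lnum (A : Matrix (Fin n) (Fin n) ℝ) (b : Fin n → ℝ) (τ : ℝ) : ℕ :=
  sSup {ℓ : ℕ | ∃ C : Fin ℓ → Finset (Fin n),
    Function.Injective C ∧ ∀ i, C i ∉ IStar A b τ} + 1

/-! ### The truncated projected CG subroutines -/

/-- The face `Ω`: `x_j = 0` on `J0`, `x_j ≤ 0` on `Jm`, `x_j ≥ 0` on `Jp`. -/
def face (J0 Jm Jp : Finset (Fin n)) : Set (Fin n → ℝ) :=
  {x | (∀ j ∈ J0, x j = 0) ∧ (∀ j ∈ Jm, x j ≤ 0) ∧ ∀ j ∈ Jp, 0 ≤ x j}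

/-- The quantities `x^k, r^k, p^k, d^k` of the first subroutine. -/
structure CGState (n : ℕ) where
  x : Fin n → ℝ
  r : Fin n → ℝ
  p : Fin n → ℝ
  d : Fin n → ℝ

/-- `α^cg = ‖p‖² / dᵀAd`, which is `∞` if `dᵀAd = 0`. -/
def alphaCG (A : Matrix (Fin n) (Fin n) ℝ) (s : CGState n) : EReal :=
  if s.d ⬝ᵥ A *ᵥ s.d = 0 then ⊤ else ((s.p ⬝ᵥ s.p / (s.d ⬝ᵥ A *ᵥ s.d) : ℝ) : EReal)

/-- `α^tc = max {α : x + α d ∈ Ω}`, which is `∞` if these `α` are unbounded above. -/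
def alphaTC (J0 Jm Jp : Finset (Fin n)) (s : CGState n) : EReal :=
  sSup ((fun a : ℝ => (a : EReal)) '' {a : ℝ | s.x + a • s.d ∈ face J0 Jm Jp})

/-- One pass of the first subroutine.  It cannot be carried out if the step length is `∞`. -/
def tpcg1Step (A : Matrix (Fin n) (Fin n) ℝ) (J0 Jm Jp : Finset (Fin n)) (ε : ℝ) :
    CGState n →. (Fin n → ℝ) ⊕ CGState n := fun s =>
  let α : EReal := min (alphaCG A s) (alphaTC J0 Jm Jp s)
  Part.assert (α ≠ ⊤) fun _ =>
    let x' := s.x + α.toReal • s.d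
    if alphaCG A s > α then Part.some (Sum.inl x')
    else
      let r' := s.r + α.toReal • (A *ᵥ s.d)
      let p' := proj J0 r'
      if ‖p'‖ ≤ ε then Part.some (Sum.inl x')
      else Part.some (Sum.inr ⟨x', r', p', -p' + ((p' ⬝ᵥ p') / (s.p ⬝ᵥ s.p)) • s.d⟩)

/-- `TPCG1(A, b, c, J0, Jm, Jp, x0, ε)` -/
def tpcg1 (A : Matrix (Fin n) (Fin n) ℝ) (b c : Fin n → ℝ) (J0 Jm Jp : Finset (Fin n))
    (x0 : Fin n → ℝ) (ε : ℝ) : Part (Fin n → ℝ) :=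
  let r0 := A *ᵥ x0 - b + c
  PFun.fix (tpcg1Step A J0 Jm Jp ε) ⟨x0, r0, proj J0 r0, -proj J0 r0⟩

/-- The quantities `x^k, J_0^k, J_-^k, J_+^k` of the second subroutine. -/
structure FaceState (n : ℕ) where
  x : Fin n → ℝ
  J0 : Finset (Fin n)
  Jm : Finset (Fin n)
  Jp : Finset (Fin n)

/-- One pass of the second subroutine. -/
def tpcg2Step (A : Matrix (Fin n) (Fin n) ℝ) (b c : Fin n → ℝ) (ε : ℝ) :
    FaceState n →. (Fin n → ℝ) ⊕ FaceState n := fun s =>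
  if ‖proj s.J0 (A *ᵥ s.x - b + c)‖ ≤ ε then Part.some (Sum.inl s.x)
  else (tpcg1 A b c s.J0 s.Jm s.Jp s.x ε).map fun x' =>
    Sum.inr ⟨x', IZero x', INeg x', IPos x'⟩

/-- `TPCG2(A, b, c, J0, Jm, Jp, x0, ε)` -/
def tpcg2 (A : Matrix (Fin n) (Fin n) ℝ) (b c : Fin n → ℝ) (J0 Jm Jp : Finset (Fin n))
    (x0 : Fin n → ℝ) (ε : ℝ) : Part (Fin n → ℝ) :=
  PFun.fix (tpcg2Step A b c ε) ⟨x0, J0, Jm, Jp⟩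

/-! ### The second generalized CG method -/

/-- One pass of the second generalized CG method.  The line search step cannot be carried out if
the denominator of its step length is zero. -/
def gcg2Step (A : Matrix (Fin n) (Fin n) ℝ) (b : Fin n → ℝ) (τ η ε : ℝ) :
    (Fin n → ℝ) →. (Fin n → ℝ) ⊕ (Fin n → ℝ) := fun x =>
  if ‖v A b τ x‖ ≤ ε then Part.some (Sum.inl x)
  else if subNorm (IZero x) (v A b τ x) > √η * subNorm (INonzero x) (v A b τ x) then
    let w := vP A b τ x
    Part.assert (w ⬝ᵥ A *ᵥ w ≠ 0) fun _ =>
      Part.some (Sum.inr (x - ((w ⬝ᵥ w) / (w ⬝ᵥ A *ᵥ w)) • w))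
  else
    (tpcg2 A b (cvec A b τ x) (IZeroZero A b τ x) (INeg x ∪ IZeroNeg A b τ x)
      (IPos x ∪ IZeroPos A b τ x) x (ε / max (√(n * η)) 1)).map Sum.inr

/-- `GCG2(A, b, τ, x0, η, ε)`: the output of the method, if it terminates. -/
def gcg2 (A : Matrix (Fin n) (Fin n) ℝ) (b : Fin n → ℝ) (τ : ℝ) (x0 : Fin n → ℝ) (η ε : ℝ) :
    Part (Fin n → ℝ) :=
  PFun.fix (gcg2Step A b τ η ε) x0

end L1QP

end

noncomputable section

namespace L1QP

open scoped Matrix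

variable {n : ℕ}

/-! ### Quadratic functions and coordinate projections -/

/-! A line search step is taken only if w = v^P(x) satisfies ‖w‖² > η‖[v(x)]_{I_0^c}‖². Along -w the
function F is exactly a quadratic, so the step lowers F by ‖w‖⁴/(2wᵀAw) ≥ ‖w‖²/(2‖A‖). By the error
bound this exceeds F(x) - F^*_x, and the new value lies strictly below F^*_x (`lineSearch_spec`). As
F never increases, no later iterate lies in the subspace attached to I_0(x), and I_0(x) is not in
I^*. Hence the finite family `reachable` loses a member at each line search (`reachable_ssubset`),
and it has fewer than L(n) members.

A TPCG2 call does not increase F and leaves |v_i| ≤ ε/max(√(nη), 1) on the nonzero components. This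
tolerance forces the next pass either to return or to do a line search (`norm_v_le_or_lineSearch`),
so two calls are never consecutive. This gives the factor 2.

The inner loops end for two reasons. In TPCG1 the projected residuals are nonzero and mutually
orthogonal, so their span grows strictly in a finite-dimensional space (`tpcg1_fix_spec`); a step
length is never infinite because F is bounded below. In TPCG2 every pass that does not reach the
tolerance stops at a new active constraint, so the zero set grows strictly (`tpcg2_fix_spec`).

The output has ‖v(y)‖_∞ ≤ ε, and v(y) is a subgradient, which gives the second claim. -/

/-- The quadratic function `½ xᵀAx - bᵀx + cᵀx`. -/
def quad (A : Matrix (Fin n) (Fin n) ℝ) (b c x : Fin n → ℝ) : ℝ :=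
  1 / 2 * (x ⬝ᵥ A *ᵥ x) - b ⬝ᵥ x + c ⬝ᵥ x

theorem dotProduct_mulVec_comm {A : Matrix (Fin n) (Fin n) ℝ} (hA : A.PosSemidef)
    (x y : Fin n → ℝ) : x ⬝ᵥ A *ᵥ y = y ⬝ᵥ A *ᵥ x := by
  have h : Aᵀ = A := by simpa using hA.1.eq
  rw [Matrix.dotProduct_mulVec, ← Matrix.mulVec_transpose, h, dotProduct_comm]

theorem dotProduct_mulVec_self_nonneg {A : Matrix (Fin n) (Fin n) ℝ} (hA : A.PosSemidef)
    (x : Fin n → ℝ) : 0 ≤ x ⬝ᵥ A *ᵥ x := by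
  simpa using hA.dotProduct_mulVec_nonneg x

theorem dotProduct_self_nonneg' (x : Fin n → ℝ) : 0 ≤ x ⬝ᵥ x := by
  simpa using dotProduct_self_star_nonneg x

theorem dotProduct_self_pos' {x : Fin n → ℝ} (hx : x ≠ 0) : 0 < x ⬝ᵥ x :=
  lt_of_le_of_ne (dotProduct_self_nonneg' x) fun h => hx (dotProduct_self_eq_zero.1 h.symm)

theorem quad_add_smul {A : Matrix (Fin n) (Fin n) ℝ} (hA : A.PosSemidef) (b c x d : Fin n → ℝ)
    (a : ℝ) : quad A b c (x + a • d) =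
      quad A b c x + a * ((A *ᵥ x - b + c) ⬝ᵥ d) + a ^ 2 / 2 * (d ⬝ᵥ A *ᵥ d) := by
  have h := dotProduct_mulVec_comm hA x d
  simp only [quad, Matrix.mulVec_add, Matrix.mulVec_smul, dotProduct_add, add_dotProduct,
    smul_dotProduct, dotProduct_smul, sub_dotProduct, smul_eq_mul, h,
    dotProduct_comm (A *ᵥ x) d]
  ring

theorem proj_dotProduct {J : Finset (Fin n)} (u : Fin n → ℝ) {w : Fin n → ℝ}
    (hw : w ∈ coordSubspace J) : proj J u ⬝ᵥ w = u ⬝ᵥ w := by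
  refine Finset.sum_congr rfl fun i _ => ?_
  by_cases hi : i ∈ J
  · simp [hw i hi]
  · simp [proj, hi]

theorem proj_mem (J : Finset (Fin n)) (u : Fin n → ℝ) : proj J u ∈ coordSubspace J :=
  fun j hj => by simp [proj, hj]

theorem proj_add_smul (J : Finset (Fin n)) (u w : Fin n → ℝ) (a : ℝ) :
    proj J (u + a • w) = proj J u + a • proj J w := by
  ext i
  by_cases hi : i ∈ J <;> simp [proj, hi]

/-- A step along `d` that does not exceed the exact line search step does not increase `quad`. -/
theorem quad_add_smul_le {A : Matrix (Fin n) (Fin n) ℝ} (hA : A.PosSemidef)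
    (b c x d : Fin n → ℝ) {a s : ℝ} (ha : 0 ≤ a) (hs : (A *ᵥ x - b + c) ⬝ᵥ d = -s) (hs0 : 0 ≤ s)
    (h : a * (d ⬝ᵥ A *ᵥ d) ≤ s) : quad A b c (x + a • d) ≤ quad A b c x := by
  rw [quad_add_smul hA, hs]
  nlinarith [mul_le_mul_of_nonneg_left h ha, mul_nonneg ha hs0]

/-! ### Steps that stay on a face -/

theorem isClosed_face (J0 Jm Jp : Finset (Fin n)) : IsClosed (face J0 Jm Jp) := by
  have : face J0 Jm Jp = (⋂ j ∈ J0, {x | x j = 0}) ∩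
      ((⋂ j ∈ Jm, {x | x j ≤ 0}) ∩ ⋂ j ∈ Jp, {x | 0 ≤ x j}) := by
    ext x; simp [face]
  rw [this]
  refine (isClosed_biInter fun j _ => ?_).inter
    ((isClosed_biInter fun j _ => ?_).inter (isClosed_biInter fun j _ => ?_))
  · exact isClosed_eq (continuous_apply j) continuous_const
  · exact isClosed_le (continuous_apply j) continuous_const
  · exact isClosed_le continuous_const (continuous_apply j)

theorem face_of_le {J0 Jm Jp : Finset (Fin n)} {x d : Fin n → ℝ} {a t : ℝ}
    (hx : x ∈ face J0 Jm Jp) (ht : x + t • d ∈ face J0 Jm Jp) (ha : 0 ≤ a) (hat : a ≤ t) :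
    x + a • d ∈ face J0 Jm Jp := by
  rcases (ha.trans hat).eq_or_lt with h0 | h0
  · have : a = 0 := le_antisymm (h0 ▸ hat) ha
    simpa [this] using hx
  have key : ∀ j, (x + a • d) j = (1 - a / t) * x j + a / t * (x + t • d) j := by
    intro j
    simp only [Pi.add_apply, Pi.smul_apply, smul_eq_mul]
    field_simp
    ring
  have h1 : 0 ≤ 1 - a / t := by rw [sub_nonneg, div_le_one h0]; exact hat
  have h2 : 0 ≤ a / t := by positivity
  refine ⟨fun j hj => ?_, fun j hj => ?_, fun j hj => ?_⟩ <;> rw [key]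
  · rw [hx.1 j hj, ht.1 j hj]; simp
  · exact add_nonpos (mul_nonpos_of_nonneg_of_nonpos h1 (hx.2.1 j hj))
      (mul_nonpos_of_nonneg_of_nonpos h2 (ht.2.1 j hj))
  · exact add_nonneg (mul_nonneg h1 (hx.2.2 j hj)) (mul_nonneg h2 (ht.2.2 j hj))

theorem alphaTC_nonneg {J0 Jm Jp : Finset (Fin n)} {s : CGState n} (hx : s.x ∈ face J0 Jm Jp) :
    0 ≤ alphaTC J0 Jm Jp s :=
  le_sSup ⟨0, by simpa using hx, rfl⟩

theorem face_of_lt_alphaTC {J0 Jm Jp : Finset (Fin n)} {s : CGState n}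
    (hx : s.x ∈ face J0 Jm Jp) {a : ℝ} (ha : 0 ≤ a) (h : (a : EReal) < alphaTC J0 Jm Jp s) :
    s.x + a • s.d ∈ face J0 Jm Jp := by
  obtain ⟨_, ⟨t, ht, rfl⟩, hat⟩ := lt_sSup_iff.1 h
  exact face_of_le hx ht ha (EReal.coe_lt_coe_iff.1 hat).le

theorem isLUB_of_alphaTC_eq {J0 Jm Jp : Finset (Fin n)} {s : CGState n} {a : ℝ}
    (h : alphaTC J0 Jm Jp s = a) : IsLUB {a : ℝ | s.x + a • s.d ∈ face J0 Jm Jp} a := by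
  constructor
  · intro t ht
    rw [← EReal.coe_le_coe_iff, ← h]
    exact le_sSup ⟨t, ht, rfl⟩
  · intro u hu
    rw [← EReal.coe_le_coe_iff, ← h]
    refine sSup_le ?_
    rintro _ ⟨t, ht, rfl⟩
    exact EReal.coe_le_coe_iff.2 (hu ht)

theorem face_of_eq_alphaTC {J0 Jm Jp : Finset (Fin n)} {s : CGState n}
    (hx : s.x ∈ face J0 Jm Jp) {a : ℝ} (h : alphaTC J0 Jm Jp s = a) :
    s.x + a • s.d ∈ face J0 Jm Jp := by
  have hc : IsClosed {a : ℝ | s.x + a • s.d ∈ face J0 Jm Jp} :=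
    (isClosed_face J0 Jm Jp).preimage (by fun_prop)
  exact hc.closure_subset ((isLUB_of_alphaTC_eq h).mem_closure ⟨0, by simpa using hx⟩)

/-- The longest feasible step makes a further constraint of the face active. -/
theorem ssubset_IZero_of_eq_alphaTC {J0 Jm Jp : Finset (Fin n)} {s : CGState n}
    (hd : s.d ∈ coordSubspace J0) (hx : s.x ∈ face J0 Jm Jp) {a : ℝ}
    (h : alphaTC J0 Jm Jp s = a) : J0 ⊂ IZero (s.x + a • s.d) := by
  have hy := face_of_eq_alphaTC hx h
  refine Finset.ssubset_iff_subset_ne.2 ⟨fun j hj => by simpa [IZero] using hy.1 j hj, ?_⟩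
  intro hJ
  have hne : ∀ j, j ∉ J0 → (s.x + a • s.d) j ≠ 0 := fun j hj h0 =>
    hj (by rw [hJ]; simpa [IZero] using h0)
  have hcont : ∀ j, Filter.Tendsto (fun t : ℝ => (s.x + t • s.d) j) (nhdsWithin a (Set.Ioi a))
      (nhds ((s.x + a • s.d) j)) := fun j => by
    have : Continuous fun t : ℝ => (s.x + t • s.d) j := by
      simp only [Pi.add_apply, Pi.smul_apply, smul_eq_mul]; fun_prop
    exact (this.tendsto a).mono_left nhdsWithin_le_nhds
  -- If no new coordinate vanished, every coordinate outside `J0` would be nonzero and keep its sign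
  -- for t slightly beyond a, while those in `J0` stay zero. A longer step would then be feasible,
  -- against the maximality of a.
  have hev : ∀ᶠ t in nhdsWithin a (Set.Ioi a), ∀ j, j ∉ J0 →
      ((s.x + a • s.d) j ≤ 0 → (s.x + t • s.d) j ≤ 0) ∧
      (0 ≤ (s.x + a • s.d) j → 0 ≤ (s.x + t • s.d) j) := by
    refine Filter.eventually_all.2 fun j => ?_
    by_cases hj : j ∈ J0
    · exact Filter.Eventually.of_forall fun t h => (h hj).elim
    rcases lt_or_gt_of_ne (hne j hj) with h0 | h0
    · filter_upwards [(hcont j).eventually (gt_mem_nhds h0)] with t ht _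
      exact ⟨fun _ => ht.le, fun h => absurd h (not_le.2 h0)⟩
    · filter_upwards [(hcont j).eventually (lt_mem_nhds h0)] with t ht _
      exact ⟨fun h => absurd h (not_le.2 h0), fun _ => ht.le⟩
  obtain ⟨t, ht, hta⟩ := (hev.and self_mem_nhdsWithin).exists
  refine absurd ((isLUB_of_alphaTC_eq h).1 (show s.x + t • s.d ∈ face J0 Jm Jp from ?_))
    (not_le.2 hta)
  have h0 : ∀ j ∈ J0, (s.x + t • s.d) j = 0 := fun j hj => by simp [hx.1 j hj, hd j hj]
  refine ⟨h0, fun j hj => ?_, fun j hj => ?_⟩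
  · by_cases hj0 : j ∈ J0
    · exact (h0 j hj0).le
    · exact (ht j hj0).1 (hy.2.1 j hj)
  · by_cases hj0 : j ∈ J0
    · exact (h0 j hj0).ge
    · exact (ht j hj0).2 (hy.2.2 j hj)

/-! ### The conjugate gradient invariant -/

/-- The relations between the current CG quantities and the span `W` of the earlier projected
residuals. -/
structure CGInvariant (A : Matrix (Fin n) (Fin n) ℝ) (b c : Fin n → ℝ) (J0 : Finset (Fin n))
    (s : CGState n) (W : Submodule ℝ (Fin n → ℝ)) : Prop where
  residual : s.r = A *ᵥ s.x - b + c
  proj_residual : s.p = proj J0 s.r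
  ne_zero : s.p ≠ 0
  orth : ∀ w ∈ W, s.p ⬝ᵥ w = 0
  conj : ∀ w ∈ W, s.d ⬝ᵥ A *ᵥ w = 0
  add_mem : s.d + s.p ∈ W
  krylov : ∀ w ∈ W, proj J0 (A *ᵥ w) ∈ W ⊔ Submodule.span ℝ {s.p}
  le_coord : ∀ w ∈ W, w ∈ coordSubspace J0

namespace CGInvariant

variable {A : Matrix (Fin n) (Fin n) ℝ} {b c : Fin n → ℝ} {J0 : Finset (Fin n)} {s : CGState n}
  {W : Submodule ℝ (Fin n → ℝ)}

theorem p_mem (h : CGInvariant A b c J0 s W) : s.p ∈ coordSubspace J0 :=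
  h.proj_residual ▸ proj_mem J0 s.r

theorem d_mem (h : CGInvariant A b c J0 s W) : s.d ∈ coordSubspace J0 := fun j hj => by
  have := h.le_coord _ h.add_mem j hj
  simpa [h.p_mem j hj] using this

theorem p_dotProduct_d (h : CGInvariant A b c J0 s W) : s.p ⬝ᵥ s.d = -(s.p ⬝ᵥ s.p) := by
  have := h.orth _ h.add_mem
  rw [dotProduct_add] at this
  linarith

theorem residual_dotProduct_d (h : CGInvariant A b c J0 s W) :
    (A *ᵥ s.x - b + c) ⬝ᵥ s.d = -(s.p ⬝ᵥ s.p) := by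
  rw [← h.residual, ← proj_dotProduct s.r h.d_mem, ← h.proj_residual, h.p_dotProduct_d]

/-- The termination measure of TPCG1: a nonzero vector orthogonal to `W` cannot lie in `W`. -/
theorem lt_sup (h : CGInvariant A b c J0 s W) : W < W ⊔ Submodule.span ℝ {s.p} := by
  refine lt_of_le_of_ne le_sup_left fun hW => h.ne_zero ?_
  have : s.p ∈ W := by
    rw [hW]; exact Submodule.mem_sup_right (Submodule.mem_span_singleton_self _)
  exact dotProduct_self_eq_zero.1 (h.orth _ this)

theorem start (A : Matrix (Fin n) (Fin n) ℝ) (b c x : Fin n → ℝ) (J0 : Finset (Fin n))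
    (hp : proj J0 (A *ᵥ x - b + c) ≠ 0) :
    CGInvariant A b c J0 ⟨x, A *ᵥ x - b + c, proj J0 (A *ᵥ x - b + c),
      -proj J0 (A *ᵥ x - b + c)⟩ ⊥ where
  residual := rfl
  proj_residual := rfl
  ne_zero := hp
  orth w hw := by simp [(Submodule.mem_bot ℝ).1 hw]
  conj w hw := by simp [(Submodule.mem_bot ℝ).1 hw]
  add_mem := by simp
  krylov w hw := by
    have : proj J0 (A *ᵥ (0 : Fin n → ℝ)) = 0 := by ext i; simp [proj]
    rw [(Submodule.mem_bot ℝ).1 hw, this]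
    exact Submodule.zero_mem _
  le_coord w hw := fun j _ => by simp [(Submodule.mem_bot ℝ).1 hw]

theorem mem_sup_iff {p w : Fin n → ℝ} :
    w ∈ W ⊔ Submodule.span ℝ {p} ↔ ∃ u ∈ W, ∃ t : ℝ, w = u + t • p := by
  rw [Submodule.mem_sup]
  constructor
  · rintro ⟨u, hu, z, hz, rfl⟩
    obtain ⟨t, rfl⟩ := Submodule.mem_span_singleton.1 hz
    exact ⟨u, hu, t, rfl⟩
  · rintro ⟨u, hu, t, rfl⟩
    exact ⟨u, hu, _, Submodule.smul_mem _ t (Submodule.mem_span_singleton_self p), rfl⟩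

/-- Since d + p ∈ `W`, adjoining p to `W` is the same as adjoining d, so relations need testing only
on `W` and on d. Orthogonality to d is the exact line search, and on `W` it is the old conjugacy.
Conjugacy on `W` follows from `krylov`, which puts the projection of Au into the enlarged space,
already orthogonal to p'. Conjugacy to d is the choice of the coefficient of d in the new direction.
-/
theorem step (hA : A.PosSemidef) (h : CGInvariant A b c J0 s W) (hd : s.d ⬝ᵥ A *ᵥ s.d ≠ 0)
    {a : ℝ} (ha : a = s.p ⬝ᵥ s.p / (s.d ⬝ᵥ A *ᵥ s.d)) {p' : Fin n → ℝ}
    (hp' : p' = proj J0 (s.r + a • (A *ᵥ s.d))) (hne : p' ≠ 0) :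
    CGInvariant A b c J0 ⟨s.x + a • s.d, s.r + a • (A *ᵥ s.d), p',
      -p' + ((p' ⬝ᵥ p') / (s.p ⬝ᵥ s.p)) • s.d⟩ (W ⊔ Submodule.span ℝ {s.p}) := by
  have hpp : s.p ⬝ᵥ s.p ≠ 0 := (dotProduct_self_pos' h.ne_zero).ne'
  have ha0 : a ≠ 0 := by rw [ha]; exact div_ne_zero hpp hd
  have hW' : ∀ w ∈ W ⊔ Submodule.span ℝ {s.p}, w ∈ coordSubspace J0 := by
    intro w hw j hj
    obtain ⟨u, hu, t, rfl⟩ := mem_sup_iff.1 hw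
    simp [h.le_coord u hu j hj, h.p_mem j hj]
  have hdW : s.d ∈ W ⊔ Submodule.span ℝ {s.p} :=
    mem_sup_iff.2 ⟨_, h.add_mem, -1, by simp⟩
  have hp'' : p' = s.p + a • proj J0 (A *ᵥ s.d) := by
    rw [hp', proj_add_smul, ← h.proj_residual]
  have hdec : ∀ w ∈ W ⊔ Submodule.span ℝ {s.p}, ∃ u ∈ W, ∃ t : ℝ, w = u + t • s.d := by
    intro w hw
    obtain ⟨u, hu, t, rfl⟩ := mem_sup_iff.1 hw
    refine ⟨u + t • (s.d + s.p), W.add_mem hu (W.smul_mem t h.add_mem), -t, ?_⟩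
    module
  have hpd : p' ⬝ᵥ s.d = 0 := by
    rw [hp'', add_dotProduct, smul_dotProduct, proj_dotProduct _ h.d_mem, h.p_dotProduct_d,
      dotProduct_comm (A *ᵥ s.d), ha, smul_eq_mul, div_mul_cancel₀ _ hd]
    ring
  have horth : ∀ w ∈ W ⊔ Submodule.span ℝ {s.p}, p' ⬝ᵥ w = 0 := by
    intro w hw
    obtain ⟨u, hu, t, rfl⟩ := hdec w hw
    rw [dotProduct_add, dotProduct_smul, hpd, hp'', add_dotProduct, smul_dotProduct,
      proj_dotProduct _ (h.le_coord u hu), h.orth u hu, dotProduct_comm (A *ᵥ s.d),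
      dotProduct_mulVec_comm hA, h.conj u hu]
    simp
  have hproj : proj J0 (A *ᵥ s.d) = a⁻¹ • (p' - s.p) := by
    rw [hp'', add_sub_cancel_left, smul_smul, inv_mul_cancel₀ ha0, one_smul]
  have hp'mem : p' ∈ coordSubspace J0 := hp' ▸ proj_mem _ _
  have hpA : ∀ w, p' ⬝ᵥ A *ᵥ w = p' ⬝ᵥ proj J0 (A *ᵥ w) := fun w => by
    rw [dotProduct_comm p' (proj _ _), proj_dotProduct _ hp'mem, dotProduct_comm]
  have hpmem : s.p ∈ W ⊔ Submodule.span ℝ {s.p} :=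
    Submodule.mem_sup_right (Submodule.mem_span_singleton_self _)
  refine ⟨?_, hp', hne, horth, ?_, ?_, ?_, hW'⟩
  · simp only [h.residual, Matrix.mulVec_add, Matrix.mulVec_smul]
    abel
  · intro w hw
    obtain ⟨u, hu, t, rfl⟩ := hdec w hw
    have e1 : p' ⬝ᵥ A *ᵥ u = 0 := by rw [hpA]; exact horth _ (h.krylov u hu)
    have e2 : p' ⬝ᵥ A *ᵥ s.d = a⁻¹ * (p' ⬝ᵥ p') := by
      rw [hpA, hproj, dotProduct_smul, dotProduct_sub, horth _ hpmem, sub_zero, smul_eq_mul]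
    simp only [Matrix.mulVec_add, Matrix.mulVec_smul, dotProduct_add, add_dotProduct,
      neg_dotProduct, smul_dotProduct, dotProduct_smul, h.conj u hu, e1, e2, smul_eq_mul]
    -- What remains is -a⁻¹‖p'‖² + (‖p'‖²/‖p‖²) dᵀAd = 0 with a = ‖p‖²/dᵀAd.
    rw [ha]
    field_simp
    ring
  · simpa using Submodule.smul_mem _ _ hdW
  · intro w hw
    obtain ⟨u, hu, t, rfl⟩ := hdec w hw
    have e : proj J0 (A *ᵥ (u + t • s.d)) = proj J0 (A *ᵥ u) + t • a⁻¹ • (p' - s.p) := by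
      rw [Matrix.mulVec_add, Matrix.mulVec_smul, proj_add_smul, hproj]
    rw [e]
    refine Submodule.add_mem _ (Submodule.mem_sup_left (h.krylov u hu))
      (Submodule.smul_mem _ _ (Submodule.smul_mem _ _ (Submodule.sub_mem _ ?_ ?_)))
    · exact Submodule.mem_sup_right (Submodule.mem_span_singleton_self _)
    · exact Submodule.mem_sup_left hpmem

end CGInvariant

/-! ### Termination of the first subroutine -/

/-- Induction on `W` along strict inclusion upwards, which is well-founded in finite dimension. The
final alternative records why the loop stopped: small residual or a blocking constraint. -/
theorem tpcg1_fix_spec {A : Matrix (Fin n) (Fin n) ℝ} (hA : A.PosSemidef) {b c : Fin n → ℝ}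
    {J0 Jm Jp : Finset (Fin n)} {ε M : ℝ} (hε : 0 ≤ ε)
    (hM : ∀ z ∈ face J0 Jm Jp, M ≤ quad A b c z) (W : Submodule ℝ (Fin n → ℝ)) :
    ∀ s : CGState n, CGInvariant A b c J0 s W → s.x ∈ face J0 Jm Jp →
    ∃ y ∈ PFun.fix (tpcg1Step A J0 Jm Jp ε) s, y ∈ face J0 Jm Jp ∧
      quad A b c y ≤ quad A b c s.x ∧
      (‖proj J0 (A *ᵥ y - b + c)‖ ≤ ε ∨ J0 ⊂ IZero y) := by
  induction W using WellFoundedGT.induction with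
  | ind W ih =>
  intro s h hx
  have hpp := dotProduct_self_pos' h.ne_zero
  have hdd := dotProduct_mulVec_self_nonneg hA s.d
  have hrd := h.residual_dotProduct_d
  have htc0 := alphaTC_nonneg hx
  have hcg0 : 0 ≤ alphaCG A s := by
    unfold alphaCG
    split_ifs
    · exact le_top
    · exact EReal.coe_nonneg.2 (div_nonneg hpp.le hdd)
  have htop : min (alphaCG A s) (alphaTC J0 Jm Jp s) ≠ ⊤ := by
    intro htop
    rw [min_eq_top] at htop
    have hd0 : s.d ⬝ᵥ A *ᵥ s.d = 0 := by
      by_contra hd0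
      have := htop.1
      rw [alphaCG, if_neg hd0] at this
      exact EReal.coe_ne_top _ this
    -- An infinite step means that dᵀAd = 0 and that the whole ray is feasible. There `quad` is
    -- affine with slope -‖p‖², so this step length reaches a value at most M - 1.
    have ht : 0 ≤ |quad A b c s.x - M| + 1 := by positivity
    have := hM _ (face_of_lt_alphaTC hx (a := (|quad A b c s.x - M| + 1) / (s.p ⬝ᵥ s.p))
      (div_nonneg ht hpp.le) (htop.2 ▸ EReal.coe_lt_top _))
    rw [quad_add_smul hA, hrd, hd0, mul_neg, div_mul_cancel₀ _ hpp.ne'] at this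
    linarith [le_abs_self (quad A b c s.x - M)]
  obtain ⟨a, haα⟩ : ∃ a : ℝ, min (alphaCG A s) (alphaTC J0 Jm Jp s) = a := by
    refine ⟨_, (EReal.coe_toReal htop ?_).symm⟩
    exact ne_bot_of_le_ne_bot (by simp) (le_min hcg0 htc0)
  have ha0 : 0 ≤ a := by
    rw [← EReal.coe_nonneg, ← haα]; exact le_min hcg0 htc0
  have hstep : tpcg1Step A J0 Jm Jp ε s = if alphaCG A s > (a : EReal) then
      Part.some (Sum.inl (s.x + a • s.d))
      else if ‖proj J0 (s.r + a • (A *ᵥ s.d))‖ ≤ ε then Part.some (Sum.inl (s.x + a • s.d))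
      else Part.some (Sum.inr ⟨s.x + a • s.d, s.r + a • (A *ᵥ s.d),
        proj J0 (s.r + a • (A *ᵥ s.d)), -proj J0 (s.r + a • (A *ᵥ s.d)) +
        ((proj J0 (s.r + a • (A *ᵥ s.d)) ⬝ᵥ proj J0 (s.r + a • (A *ᵥ s.d))) / (s.p ⬝ᵥ s.p)) •
          s.d⟩) := by
    unfold tpcg1Step
    simp only [Part.assert_pos htop, haα, EReal.toReal_coe]
  by_cases hlt : alphaCG A s > (a : EReal)
  · have hatc : alphaTC J0 Jm Jp s = a := by
      rcases min_choice (alphaCG A s) (alphaTC J0 Jm Jp s) with hm | hm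
      · exact absurd (hm.symm.trans haα) hlt.ne'
      · exact hm.symm.trans haα
    refine ⟨s.x + a • s.d, ?_, face_of_eq_alphaTC hx hatc, ?_,
      Or.inr (ssubset_IZero_of_eq_alphaTC h.d_mem hx hatc)⟩
    · refine PFun.mem_fix_iff.2 (Or.inl ?_)
      rw [hstep, if_pos hlt]
      exact Part.mem_some _
    · refine quad_add_smul_le hA b c _ _ ha0 hrd hpp.le ?_
      by_cases hd0 : s.d ⬝ᵥ A *ᵥ s.d = 0
      · rw [hd0, mul_zero]; exact hpp.le
      · rw [alphaCG, if_neg hd0] at hlt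
        exact ((le_div_iff₀ (lt_of_le_of_ne hdd (Ne.symm hd0))).1 (EReal.coe_lt_coe_iff.1 hlt).le)
  · have hacg : alphaCG A s = a := le_antisymm (not_lt.1 hlt) (haα ▸ min_le_left _ _)
    have hd0 : s.d ⬝ᵥ A *ᵥ s.d ≠ 0 := by
      intro hd0
      rw [alphaCG, if_pos hd0] at hacg
      exact EReal.coe_ne_top _ hacg.symm
    have hadiv : a = s.p ⬝ᵥ s.p / (s.d ⬝ᵥ A *ᵥ s.d) := by
      rw [alphaCG, if_neg hd0] at hacg
      exact (EReal.coe_eq_coe_iff.1 hacg).symm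
    have hface : s.x + a • s.d ∈ face J0 Jm Jp := by
      have hle : (a : EReal) ≤ alphaTC J0 Jm Jp s := haα ▸ min_le_right _ _
      rcases hle.eq_or_lt with he | hl
      · exact face_of_eq_alphaTC hx he.symm
      · exact face_of_lt_alphaTC hx ha0 hl
    have hq : quad A b c (s.x + a • s.d) ≤ quad A b c s.x :=
      quad_add_smul_le hA b c _ _ ha0 hrd hpp.le (by rw [hadiv, div_mul_cancel₀ _ hd0])
    by_cases hp' : ‖proj J0 (s.r + a • (A *ᵥ s.d))‖ ≤ ε
    · refine ⟨s.x + a • s.d, ?_, hface, hq, Or.inl ?_⟩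
      · refine PFun.mem_fix_iff.2 (Or.inl ?_)
        rw [hstep, if_neg hlt, if_pos hp']
        exact Part.mem_some _
      · convert hp' using 3
        rw [h.residual, Matrix.mulVec_add, Matrix.mulVec_smul]
        abel
    · have hne : proj J0 (s.r + a • (A *ᵥ s.d)) ≠ 0 := fun h0 => hp' (by rw [h0]; simpa using hε)
      obtain ⟨y, hy, hyf, hyq, hyε⟩ := ih _ h.lt_sup _ (h.step hA hd0 hadiv rfl hne) hface
      refine ⟨y, PFun.mem_fix_iff.2 (Or.inr ⟨_, ?_, hy⟩), hyf, hyq.trans hq, hyε⟩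
      rw [hstep, if_neg hlt, if_neg hp']
      exact Part.mem_some _

theorem tpcg1_spec {A : Matrix (Fin n) (Fin n) ℝ} (hA : A.PosSemidef) {b c : Fin n → ℝ}
    {J0 Jm Jp : Finset (Fin n)} {ε M : ℝ} (hε : 0 ≤ ε)
    (hM : ∀ z ∈ face J0 Jm Jp, M ≤ quad A b c z) {x : Fin n → ℝ} (hx : x ∈ face J0 Jm Jp)
    (hp : ¬ ‖proj J0 (A *ᵥ x - b + c)‖ ≤ ε) :
    ∃ y ∈ tpcg1 A b c J0 Jm Jp x ε, y ∈ face J0 Jm Jp ∧ quad A b c y ≤ quad A b c x ∧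
      (‖proj J0 (A *ᵥ y - b + c)‖ ≤ ε ∨ J0 ⊂ IZero y) := by
  refine tpcg1_fix_spec hA hε hM ⊥ _ (CGInvariant.start A b c x J0 fun h0 => hp ?_) hx
  rw [h0]; simpa using hε

/-! ### Termination of the second subroutine -/

/-- On the face given by `J0`, `Jm`, `Jp`, the linear function `cᵀx` is `τ‖x‖₁`. -/
def Compatible (τ : ℝ) (c : Fin n → ℝ) (J0 Jm Jp : Finset (Fin n)) : Prop :=
  ∀ j, j ∈ J0 ∨ (j ∈ Jm ∧ c j = -τ) ∨ (j ∈ Jp ∧ c j = τ)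

/-- This turns descent of the smooth function `quad` inside a face into descent of F, and the
minimum of F into a lower bound for `quad`. -/
theorem Compatible.quad_eq_F {A : Matrix (Fin n) (Fin n) ℝ} {b c : Fin n → ℝ} {τ : ℝ}
    {J0 Jm Jp : Finset (Fin n)} (h : Compatible τ c J0 Jm Jp) {x : Fin n → ℝ}
    (hx : x ∈ face J0 Jm Jp) : quad A b c x = F A b τ x := by
  have : c ⬝ᵥ x = τ * ∑ i, |x i| := by
    rw [Finset.mul_sum]
    refine Finset.sum_congr rfl fun j _ => ?_
    rcases h j with hj | ⟨hj, hc⟩ | ⟨hj, hc⟩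
    · simp [hx.1 j hj]
    · rw [hc, abs_of_nonpos (hx.2.1 j hj)]; ring
    · rw [hc, abs_of_nonneg (hx.2.2 j hj)]
  rw [quad, F, this]

theorem Compatible.of_mem_face {c : Fin n → ℝ} {τ : ℝ}
    {J0 Jm Jp : Finset (Fin n)} (h : Compatible τ c J0 Jm Jp) {x : Fin n → ℝ}
    (hx : x ∈ face J0 Jm Jp) : Compatible τ c (IZero x) (INeg x) (IPos x) := by
  intro j
  simp only [IZero, INeg, IPos, Finset.mem_filter, Finset.mem_univ, true_and]
  rcases h j with hj | ⟨hj, hc⟩ | ⟨hj, hc⟩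
  · exact Or.inl (hx.1 j hj)
  · rcases (hx.2.1 j hj).eq_or_lt with h0 | h0
    · exact Or.inl h0
    · exact Or.inr (Or.inl ⟨h0, hc⟩)
  · rcases (hx.2.2 j hj).eq_or_lt with h0 | h0
    · exact Or.inl h0.symm
    · exact Or.inr (Or.inr ⟨h0, hc⟩)

theorem mem_face_self (x : Fin n → ℝ) : x ∈ face (IZero x) (INeg x) (IPos x) := by
  refine ⟨fun j hj => ?_, fun j hj => ?_, fun j hj => ?_⟩
  · simpa [IZero] using hj
  · exact le_of_lt (by simpa [INeg] using hj)
  · exact le_of_lt (by simpa [IPos] using hj)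

theorem norm_proj_le {I J : Finset (Fin n)} (h : I ⊆ J) (u : Fin n → ℝ) :
    ‖proj J u‖ ≤ ‖proj I u‖ := by
  refine (pi_norm_le_iff_of_nonneg (norm_nonneg _)).2 fun i => ?_
  by_cases hi : i ∈ J
  · simp [proj, hi]
  · have hi' : i ∉ I := fun h' => hi (h h')
    have := norm_le_pi_norm (proj I u) i
    simpa [proj, hi, hi'] using this

theorem abs_v_le_of_norm_proj_le {A : Matrix (Fin n) (Fin n) ℝ} {b c : Fin n → ℝ} {τ ε : ℝ}
    {x : Fin n → ℝ} (hc : Compatible τ c (IZero x) (INeg x) (IPos x))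
    (h : ‖proj (IZero x) (A *ᵥ x - b + c)‖ ≤ ε) (i : Fin n) (hi : x i ≠ 0) :
    |v A b τ x i| ≤ ε := by
  have hn := (norm_le_pi_norm (proj (IZero x) (A *ᵥ x - b + c)) i).trans h
  have hi0 : i ∉ IZero x := by simpa [IZero] using hi
  have hv : v A b τ x i = proj (IZero x) (A *ᵥ x - b + c) i := by
    simp only [v, if_neg hi, proj, if_neg hi0, grad, Pi.add_apply]
    rcases hc i with hj | ⟨hj, hc⟩ | ⟨hj, hc⟩
    · exact absurd hj hi0
    · rw [hc, Real.sign_of_neg (by simpa [INeg] using hj)]; ring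
    · rw [hc, Real.sign_of_pos (by simpa [IPos] using hj)]; ring
  rwa [hv, ← Real.norm_eq_abs]

/-- Induction on `J0` along strict inclusion upwards. An immediate return is kept as a separate
case, because the initial `J0` may be smaller than `IZero x`; only after a TPCG1 pass do the two
agree, and then the projected residual is v on the nonzero components. -/
theorem tpcg2_fix_spec {A : Matrix (Fin n) (Fin n) ℝ} (hA : A.PosSemidef) {b c : Fin n → ℝ}
    {τ ε : ℝ} (hopt : ∃ z, IsOptimal A b τ z) (hε : 0 ≤ ε) (J0 : Finset (Fin n)) :
    ∀ (x : Fin n → ℝ) (Jm Jp : Finset (Fin n)), Compatible τ c J0 Jm Jp → x ∈ face J0 Jm Jp →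
    ∃ y ∈ PFun.fix (tpcg2Step A b c ε) ⟨x, J0, Jm, Jp⟩,
      (‖proj J0 (A *ᵥ x - b + c)‖ ≤ ε ∧ y = x) ∨ (F A b τ y ≤ F A b τ x ∧
        ∀ i, y i ≠ 0 → |v A b τ y i| ≤ ε) := by
  induction J0 using WellFoundedGT.induction with
  | ind J0 ih =>
  intro x Jm Jp hc hx
  by_cases hp : ‖proj J0 (A *ᵥ x - b + c)‖ ≤ ε
  · refine ⟨x, PFun.mem_fix_iff.2 (Or.inl ?_), Or.inl ⟨hp, rfl⟩⟩
    simp [tpcg2Step, if_pos hp]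
  · obtain ⟨z, hz⟩ := hopt
    obtain ⟨x', hx', hf, hq, hend⟩ := tpcg1_spec hA hε
      (fun w hw => (hz w).trans_eq (hc.quad_eq_F hw).symm) hx hp
    rw [hc.quad_eq_F hf, hc.quad_eq_F hx] at hq
    have hc' := hc.of_mem_face hf
    have hmem : Sum.inr ⟨x', IZero x', INeg x', IPos x'⟩ ∈ tpcg2Step A b c ε ⟨x, J0, Jm, Jp⟩ := by
      rw [tpcg2Step, if_neg hp]
      exact (Part.mem_map_iff _).2 ⟨x', hx', rfl⟩
    by_cases hp' : ‖proj (IZero x') (A *ᵥ x' - b + c)‖ ≤ ε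
    · refine ⟨x', PFun.mem_fix_iff.2 (Or.inr ⟨_, hmem, PFun.mem_fix_iff.2 (Or.inl ?_)⟩),
        Or.inr ⟨hq, abs_v_le_of_norm_proj_le hc' hp'⟩⟩
      simp [tpcg2Step, if_pos hp']
    -- TPCG1 cannot have stopped because of a small residual: projecting further, from `J0` to
    -- `IZero x'`, only shrinks the norm.
    · have hsub : J0 ⊂ IZero x' := by
        refine hend.resolve_left fun h => hp' ((norm_proj_le ?_ _).trans h)
        intro j hj
        simpa [IZero] using hf.1 j hj
      obtain ⟨y, hy, hyx⟩ := ih _ hsub x' _ _ hc' (mem_face_self x')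
      have hyx' := hyx.resolve_left fun h => hp' h.1
      exact ⟨y, PFun.mem_fix_iff.2 (Or.inr ⟨_, hmem, hy⟩), Or.inr ⟨hyx'.1.trans hq, hyx'.2⟩⟩

theorem compatible_cvec (A : Matrix (Fin n) (Fin n) ℝ) (b : Fin n → ℝ) (τ : ℝ) (x : Fin n → ℝ) :
    Compatible τ (cvec A b τ x) (IZeroZero A b τ x) (INeg x ∪ IZeroNeg A b τ x)
      (IPos x ∪ IZeroPos A b τ x) := by
  intro j
  by_cases hp : j ∈ IPos x ∪ IZeroPos A b τ x
  · exact Or.inr (Or.inr ⟨hp, by rw [cvec, if_pos hp]⟩)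
  by_cases hm : j ∈ INeg x ∪ IZeroNeg A b τ x
  · exact Or.inr (Or.inl ⟨hm, by rw [cvec, if_neg hp, if_pos hm]⟩)
  left
  simp only [IPos, IZeroPos, INeg, IZeroNeg, IZeroZero, Finset.mem_union, Finset.mem_filter,
    Finset.mem_univ, true_and, not_or, not_and, not_lt] at *
  have h0 : x j = 0 := le_antisymm hp.1 hm.1
  exact ⟨h0, hm.2 h0, hp.2 h0⟩

theorem mem_face_start (A : Matrix (Fin n) (Fin n) ℝ) (b : Fin n → ℝ) (τ : ℝ) (x : Fin n → ℝ) :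
    x ∈ face (IZeroZero A b τ x) (INeg x ∪ IZeroNeg A b τ x) (IPos x ∪ IZeroPos A b τ x) := by
  simp only [face, IPos, IZeroPos, INeg, IZeroNeg, IZeroZero, Finset.mem_union, Finset.mem_filter,
    Finset.mem_univ, true_and, Set.mem_ofPred_eq]
  refine ⟨fun j h => h.1, fun j h => ?_, fun j h => ?_⟩
  · exact h.elim le_of_lt fun h => h.1.le
  · exact h.elim le_of_lt fun h => h.1.ge

/-- Thus the first test of TPCG2 is a test on ‖v(x)‖_∞, so a call made while this is above the
tolerance runs TPCG1 at least once. -/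
theorem proj_add_cvec {A : Matrix (Fin n) (Fin n) ℝ} {b : Fin n → ℝ} {τ : ℝ} (hτ : 0 ≤ τ)
    (x : Fin n → ℝ) : proj (IZeroZero A b τ x) (A *ᵥ x - b + cvec A b τ x) = v A b τ x := by
  ext i
  change proj (IZeroZero A b τ x) (grad A b x + cvec A b τ x) i = v A b τ x i
  simp only [proj, cvec, v, IPos, IZeroPos, INeg, IZeroNeg, IZeroZero, Finset.mem_union,
    Finset.mem_filter, Finset.mem_univ, true_and, Pi.add_apply]
  generalize grad A b x i = g
  rcases lt_trichotomy (x i) 0 with hi | hi | hi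
  · simp [hi.ne, hi, hi.not_gt, Real.sign_of_neg hi]
  · simp only [hi, lt_irrefl, true_and, false_or, if_true]
    split_ifs with h1 h2 h3
    · rw [max_eq_left h1.1, min_eq_right h1.2]
    · rw [max_eq_left (by linarith), min_eq_left h2.le]
    · rw [max_eq_right h3.le, min_eq_right (by linarith)]; ring
    · exact absurd ⟨not_lt.1 h3, not_lt.1 h2⟩ h1
  · simp [hi.ne', hi, Real.sign_of_pos hi]

/-- The call of the second subroutine at a point where the stopping criterion is violated. -/
theorem tpcg2_spec {A : Matrix (Fin n) (Fin n) ℝ} (hA : A.PosSemidef) {b : Fin n → ℝ}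
    {τ ε : ℝ} (hτ : 0 ≤ τ) (hopt : ∃ z, IsOptimal A b τ z) (hε : 0 ≤ ε) {x : Fin n → ℝ}
    (hx : ¬ ‖v A b τ x‖ ≤ ε) :
    ∃ y ∈ tpcg2 A b (cvec A b τ x) (IZeroZero A b τ x) (INeg x ∪ IZeroNeg A b τ x)
      (IPos x ∪ IZeroPos A b τ x) x ε,
      F A b τ y ≤ F A b τ x ∧ ∀ i, y i ≠ 0 → |v A b τ y i| ≤ ε := by
  obtain ⟨y, hy, h⟩ := tpcg2_fix_spec hA hopt hε _ x _ _ (compatible_cvec A b τ x)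
    (mem_face_start A b τ x)
  rw [proj_add_cvec hτ] at h
  exact ⟨y, hy, h.resolve_left fun h => hx h.1⟩

/-! ### The line search step -/

theorem dotProduct_mulVec_le_specNorm (A : Matrix (Fin n) (Fin n) ℝ) (w : Fin n → ℝ) :
    w ⬝ᵥ A *ᵥ w ≤ specNorm A * (w ⬝ᵥ w) := by
  have h1 := Matrix.inner_toEuclideanCLM A (WithLp.toLp 2 w) (WithLp.toLp 2 w)
  have h2 : ‖WithLp.toLp 2 w‖ ^ 2 = w ⬝ᵥ w := by
    rw [EuclideanSpace.norm_sq_eq]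
    exact Finset.sum_congr rfl fun i _ => by rw [Real.norm_eq_abs, sq_abs, pow_two]
  rw [show w ⬝ᵥ A *ᵥ w = _ from h1.symm, ← h2]
  refine (real_inner_le_norm _ _).trans ?_
  have := ContinuousLinearMap.le_opNorm (Matrix.toEuclideanCLM (n := Fin n) (𝕜 := ℝ) A)
    (WithLp.toLp 2 w)
  calc _ ≤ ‖WithLp.toLp 2 w‖ * (specNorm A * ‖WithLp.toLp 2 w‖) :=
        mul_le_mul_of_nonneg_left this (norm_nonneg _)
    _ = _ := by ring

/-- With w = v^P(x), only components that are zero in x move, so |x_i - a w_i| = |x_i| + a|w_i| and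
the ℓ¹ term is affine in a ≥ 0. The min-max formula for v gives ∇_i f(x) w_i - τ|w_i| = w_i², hence
the slope -‖w‖² at a = 0. -/
theorem F_sub_smul_vP {A : Matrix (Fin n) (Fin n) ℝ} (hA : A.PosSemidef) (b : Fin n → ℝ) {τ : ℝ}
    (hτ : 0 ≤ τ) (x : Fin n → ℝ) {a : ℝ} (ha : 0 ≤ a) :
    F A b τ (x - a • vP A b τ x) = F A b τ x - a * (vP A b τ x ⬝ᵥ vP A b τ x) +
      a ^ 2 / 2 * (vP A b τ x ⬝ᵥ A *ᵥ vP A b τ x) := by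
  have hF : ∀ z, F A b τ z = quad A b 0 z + τ * ∑ i, |z i| := fun z => by simp [F, quad]
  have key : ∀ i, grad A b x i * vP A b τ x i - τ * |vP A b τ x i| =
      vP A b τ x i * vP A b τ x i := by
    intro i
    by_cases hi : x i = 0
    · have hi' : i ∈ IZero x := by simpa [IZero] using hi
      simp only [vP, if_pos hi', v, if_pos hi]
      generalize grad A b x i = g
      rcases le_total 0 (g - τ) with h | h
      · rw [max_eq_right h, min_eq_right (by linarith), abs_of_nonneg h]; ring
      · rw [max_eq_left h]
        rcases le_total 0 (g + τ) with h' | h'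
        · rw [min_eq_right h']; simp
        · rw [min_eq_left h', abs_of_nonpos h']; ring
    · have hi' : i ∉ IZero x := by simpa [IZero] using hi
      simp [vP, if_neg hi']
  have habs : ∀ i, |(x - a • vP A b τ x) i| = |x i| + a * |vP A b τ x i| := by
    intro i
    by_cases hi : x i = 0
    · simp [hi, abs_mul, abs_of_nonneg ha]
    · have hi' : i ∉ IZero x := by simpa [IZero] using hi
      simp [vP, if_neg hi']
  have hsum : grad A b x ⬝ᵥ vP A b τ x - τ * ∑ i, |vP A b τ x i| = vP A b τ x ⬝ᵥ vP A b τ x := by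
    rw [Finset.mul_sum, dotProduct, ← Finset.sum_sub_distrib]
    exact Finset.sum_congr rfl fun i _ => key i
  rw [hF, hF, sub_eq_add_neg, ← neg_smul, quad_add_smul hA, neg_smul, ← sub_eq_add_neg, add_zero]
  change quad A b 0 x + -a * (grad A b x ⬝ᵥ vP A b τ x) + _ + _ = _
  rw [Finset.sum_congr rfl fun i _ => habs i, Finset.sum_add_distrib, ← Finset.mul_sum, ← hsum]
  ring

theorem subNorm_IZero_sq (A : Matrix (Fin n) (Fin n) ℝ) (b : Fin n → ℝ) (τ : ℝ) (x : Fin n → ℝ) :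
    subNorm (IZero x) (v A b τ x) ^ 2 = vP A b τ x ⬝ᵥ vP A b τ x := by
  rw [subNorm, Real.sq_sqrt (Finset.sum_nonneg fun i _ => sq_nonneg _), dotProduct,
    ← Finset.sum_subset (Finset.subset_univ (IZero x))]
  · exact Finset.sum_congr rfl fun i hi => by rw [vP, if_pos hi, pow_two]
  · intro i _ hi
    rw [vP, if_neg hi, zero_mul]

theorem subNorm_nonneg (J : Finset (Fin n)) (u : Fin n → ℝ) : 0 ≤ subNorm J u :=
  Real.sqrt_nonneg _

theorem FStar_le {A : Matrix (Fin n) (Fin n) ℝ} {b : Fin n → ℝ} {τ : ℝ}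
    (hopt : ∃ z, IsOptimal A b τ z) {x z : Fin n → ℝ} (hz : z ∈ coordSubspace (IZero x)) :
    FStar A b τ x ≤ F A b τ z := by
  obtain ⟨o, ho⟩ := hopt
  refine csInf_le ⟨F A b τ o, ?_⟩ ⟨z, hz, rfl⟩
  rintro _ ⟨w, -, rfl⟩
  exact ho w

/-- The line search step is defined and leads below the minimum of `F` on the current face. -/
theorem lineSearch_spec {A : Matrix (Fin n) (Fin n) ℝ} (hA : A.PosSemidef) {b : Fin n → ℝ} {τ : ℝ}
    (hτ : 0 ≤ τ) (hopt : ∃ z, IsOptimal A b τ z) {x : Fin n → ℝ} {η : ℝ} (hη : 0 < η)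
    (herr : 2 * specNorm A * (F A b τ x - FStar A b τ x) ≤
      η * subNorm (INonzero x) (v A b τ x) ^ 2)
    (h : subNorm (IZero x) (v A b τ x) > √η * subNorm (INonzero x) (v A b τ x)) :
    vP A b τ x ⬝ᵥ A *ᵥ vP A b τ x ≠ 0 ∧
    F A b τ (x - ((vP A b τ x ⬝ᵥ vP A b τ x) / (vP A b τ x ⬝ᵥ A *ᵥ vP A b τ x)) • vP A b τ x) <
      FStar A b τ x := by
  have hsq : η * subNorm (INonzero x) (v A b τ x) ^ 2 < vP A b τ x ⬝ᵥ vP A b τ x := by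
    rw [← subNorm_IZero_sq]
    calc _ = (√η * subNorm (INonzero x) (v A b τ x)) ^ 2 := by rw [mul_pow, Real.sq_sqrt hη.le]
      _ < _ := pow_lt_pow_left₀ h (mul_nonneg (Real.sqrt_nonneg _) (subNorm_nonneg _ _)) two_ne_zero
  have hww : 0 < vP A b τ x ⬝ᵥ vP A b τ x :=
    lt_of_le_of_lt (mul_nonneg hη.le (sq_nonneg _)) hsq
  have hF := fun a ha => F_sub_smul_vP hA b hτ x (a := a) ha
  have hN := dotProduct_mulVec_le_specNorm A (vP A b τ x)
  have hwA := dotProduct_mulVec_self_nonneg hA (vP A b τ x)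
  set w := vP A b τ x with hw
  -- Otherwise F would decrease linearly along -w; the step below would reach a value under the
  -- minimum.
  have hne : w ⬝ᵥ A *ᵥ w ≠ 0 := by
    intro h0
    obtain ⟨z, hz⟩ := hopt
    have ht : 0 ≤ |F A b τ x - F A b τ z| + 1 := by positivity
    have := hz (x - ((|F A b τ x - F A b τ z| + 1) / (w ⬝ᵥ w)) • w)
    rw [hF _ (div_nonneg ht hww.le), h0, div_mul_cancel₀ _ hww.ne'] at this
    linarith [le_abs_self (F A b τ x - F A b τ z)]
  refine ⟨hne, ?_⟩
  have hpos : 0 < w ⬝ᵥ A *ᵥ w := lt_of_le_of_ne hwA (Ne.symm hne)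
  rw [hF _ (div_nonneg hww.le hwA)]
  have hNpos : 0 < specNorm A := pos_of_mul_pos_left (hpos.trans_le hN) hww.le
  have e : F A b τ x - w ⬝ᵥ w / (w ⬝ᵥ A *ᵥ w) * (w ⬝ᵥ w) +
      (w ⬝ᵥ w / (w ⬝ᵥ A *ᵥ w)) ^ 2 / 2 * (w ⬝ᵥ A *ᵥ w) =
      F A b τ x - (w ⬝ᵥ w) ^ 2 / (w ⬝ᵥ A *ᵥ w) / 2 := by
    field_simp
    ring
  rw [e]
  -- The decrease is half of ‖w‖⁴/wᵀAw, so 2‖A‖ times it is at least ‖w‖². Were the new value not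
  -- below F^*_x, then 2‖A‖(F(x) - F^*_x) ≥ ‖w‖² would contradict `herr` and `hsq`.
  have h1 : w ⬝ᵥ w ≤ specNorm A * ((w ⬝ᵥ w) ^ 2 / (w ⬝ᵥ A *ᵥ w)) := by
    rw [← mul_div_assoc, le_div_iff₀ hpos]
    nlinarith [mul_le_mul_of_nonneg_left hN hww.le]
  by_contra hcon
  rw [not_lt] at hcon
  nlinarith [mul_le_mul_of_nonneg_left hcon hNpos.le]

/-! ### The stopping criterion -/

/-- `v(x)` is a subgradient of `F` at `x`. -/
theorem v_mem_subdiff {A : Matrix (Fin n) (Fin n) ℝ} (hA : A.PosSemidef) (b : Fin n → ℝ) {τ : ℝ}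
    (hτ : 0 ≤ τ) (x : Fin n → ℝ) : v A b τ x ∈ subdiff A b τ x := by
  intro z
  have hF : ∀ z, F A b τ z = quad A b 0 z + τ * ∑ i, |z i| := fun z => by simp [F, quad]
  have hq := quad_add_smul hA b 0 x (z - x) 1
  rw [one_smul, add_sub_cancel, add_zero] at hq
  have key : ∀ i, τ * |x i| + v A b τ x i * (z - x) i ≤
      grad A b x i * (z - x) i + τ * |z i| := by
    intro i
    simp only [v, Pi.sub_apply]
    generalize grad A b x i = g
    rcases lt_trichotomy (x i) 0 with hi | hi | hi
    · rw [if_neg hi.ne, Real.sign_of_neg hi, abs_of_neg hi]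
      nlinarith [mul_le_mul_of_nonneg_left (neg_le_abs (z i)) hτ]
    · rw [if_pos hi, hi]
      -- At a zero component v_i - g lies in [-τ, τ], the subdifferential of τ|·| at 0.
      have h1 : |min (g + τ) (max 0 (g - τ)) - g| ≤ τ := by
        rw [abs_le]
        constructor
        · rw [neg_le_sub_iff_le_add, ← sub_le_iff_le_add]
          exact le_min (by linarith) (le_max_right _ _)
        · linarith [min_le_left (g + τ) (max 0 (g - τ))]
      have h2 := (le_abs_self _).trans_eq (abs_mul (min (g + τ) (max 0 (g - τ)) - g) (z i))
      have h3 := mul_le_mul_of_nonneg_right h1 (abs_nonneg (z i))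
      rw [abs_zero]
      linarith
    · rw [if_neg hi.ne', Real.sign_of_pos hi, abs_of_pos hi]
      nlinarith [mul_le_mul_of_nonneg_left (le_abs_self (z i)) hτ]
  have hsum : τ * ∑ i, |x i| + v A b τ x ⬝ᵥ (z - x) ≤
      grad A b x ⬝ᵥ (z - x) + τ * ∑ i, |z i| := by
    rw [Finset.mul_sum, Finset.mul_sum, dotProduct, dotProduct, ← Finset.sum_add_distrib,
      ← Finset.sum_add_distrib]
    exact Finset.sum_le_sum fun i _ => key i
  have hnn := dotProduct_mulVec_self_nonneg hA (z - x)
  rw [hF, hF, hq]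
  change _ ≤ quad A b 0 x + 1 * (grad A b x ⬝ᵥ (z - x)) + _ + _
  linarith

theorem isOptimal_of_zero_mem_subdiff {A : Matrix (Fin n) (Fin n) ℝ} {b : Fin n → ℝ} {τ : ℝ}
    {x : Fin n → ℝ} (h : (0 : Fin n → ℝ) ∈ subdiff A b τ x) : IsOptimal A b τ x := fun z => by
  simpa using h z

theorem norm_v_le_of_mem_gcg2 {A : Matrix (Fin n) (Fin n) ℝ} {b : Fin n → ℝ} {τ η ε : ℝ}
    {x y : Fin n → ℝ} (hy : y ∈ gcg2 A b τ x η ε) : ‖v A b τ y‖ ≤ ε := by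
  obtain ⟨k, hk⟩ := (mem_fix_iff_loopReturns _ _ _).1 hy
  clear hy
  induction k generalizing x with
  | zero => exact hk.elim
  | succ k ih =>
    rcases hk with h | ⟨x', -, h⟩
    · unfold gcg2Step at h
      split_ifs at h with h1 h2
      · obtain rfl : y = x := by simpa using h
        exact h1
      · obtain ⟨_, h⟩ := Part.mem_assert_iff.1 h
        simp at h
      · simp at h
    · exact ih h

/-- A small `v` on the nonzero components is followed by a return or a line search step. -/
theorem norm_v_le_or_lineSearch {A : Matrix (Fin n) (Fin n) ℝ} {b : Fin n → ℝ} {τ η ε : ℝ}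
    (hε : 0 ≤ ε) {y : Fin n → ℝ}
    (h : ∀ i, y i ≠ 0 → |v A b τ y i| ≤ ε / max (√(n * η)) 1) :
    ‖v A b τ y‖ ≤ ε ∨
      subNorm (IZero y) (v A b τ y) > √η * subNorm (INonzero y) (v A b τ y) := by
  refine or_iff_not_imp_right.2 fun hls => (pi_norm_le_iff_of_nonneg hε).2 fun i => ?_
  rw [not_lt] at hls
  set m := max (√(n * η)) 1 with hm
  have hm1 : 1 ≤ m := le_max_right _ _
  have hm0 : 0 < m := one_pos.trans_le hm1
  have hδ : 0 ≤ ε / m := div_nonneg hε hm0.le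
  rw [Real.norm_eq_abs]
  by_cases hi : y i = 0
  · have h1 : |v A b τ y i| ≤ subNorm (IZero y) (v A b τ y) := by
      rw [← Real.sqrt_sq_eq_abs]
      exact Real.sqrt_le_sqrt (Finset.single_le_sum (f := fun i => v A b τ y i ^ 2)
        (fun _ _ => sq_nonneg _) (by simpa [IZero] using hi))
    have h2 : subNorm (INonzero y) (v A b τ y) ≤ √n * (ε / m) := by
      rw [← Real.sqrt_sq hδ, ← Real.sqrt_mul (Nat.cast_nonneg n)]
      refine Real.sqrt_le_sqrt ?_
      calc ∑ i ∈ INonzero y, v A b τ y i ^ 2 ≤ ∑ i ∈ INonzero y, (ε / m) ^ 2 := by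
            refine Finset.sum_le_sum fun i hi => ?_
            rw [← sq_abs (v A b τ y i)]
            exact pow_le_pow_left₀ (abs_nonneg _) (h i (by simpa [INonzero] using hi)) 2
        _ = (INonzero y).card * (ε / m) ^ 2 := by rw [Finset.sum_const, nsmul_eq_mul]
        _ ≤ n * (ε / m) ^ 2 := by
            refine mul_le_mul_of_nonneg_right ?_ (sq_nonneg _)
            exact_mod_cast (Finset.card_le_univ _).trans_eq (Fintype.card_fin n)
    -- The factor √(nη) in the tolerance comes from here: √η from the failed line search test, √n
    -- from at most n nonzero components.
    calc |v A b τ y i| ≤ √η * (√n * (ε / m)) :=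
          (h1.trans hls).trans (mul_le_mul_of_nonneg_left h2 (Real.sqrt_nonneg _))
      _ = √(n * η) * (ε / m) := by rw [Real.sqrt_mul (Nat.cast_nonneg n)]; ring
      _ ≤ m * (ε / m) := mul_le_mul_of_nonneg_right (le_max_left _ _) hδ
      _ = ε := mul_div_cancel₀ _ hm0.ne'
  · exact (h i hi).trans (div_le_self hε hm1)

/-! ### Counting the passes -/

open scoped Classical in
/-- The index sets outside `I^*` whose coordinate subspace meets the sublevel set of `x`. -/
def reachable (A : Matrix (Fin n) (Fin n) ℝ) (b : Fin n → ℝ) (τ : ℝ) (x : Fin n → ℝ) :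
    Finset (Finset (Fin n)) :=
  {J | J ∉ IStar A b τ ∧ ∃ z ∈ coordSubspace J, F A b τ z ≤ F A b τ x}

theorem mem_reachable {A : Matrix (Fin n) (Fin n) ℝ} {b : Fin n → ℝ} {τ : ℝ} {x : Fin n → ℝ}
    {J : Finset (Fin n)} : J ∈ reachable A b τ x ↔
      J ∉ IStar A b τ ∧ ∃ z ∈ coordSubspace J, F A b τ z ≤ F A b τ x := by
  simp [reachable]

theorem reachable_mono {A : Matrix (Fin n) (Fin n) ℝ} {b : Fin n → ℝ} {τ : ℝ} {x y : Fin n → ℝ}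
    (h : F A b τ y ≤ F A b τ x) : reachable A b τ y ⊆ reachable A b τ x := fun J hJ => by
  obtain ⟨h1, z, hz, hF⟩ := mem_reachable.1 hJ
  exact mem_reachable.2 ⟨h1, z, hz, hF.trans h⟩

theorem self_mem_coordSubspace (x : Fin n → ℝ) : x ∈ coordSubspace (IZero x) :=
  fun j hj => by simpa [IZero] using hj

/-- The member lost is I_0(x). It belongs to the family of x, with x itself as witness: an optimal
point vanishing on I_0(x) would have value at least F^*_x > F(y). It is not in the family of y,
since F exceeds F(y) on the whole subspace. -/
theorem reachable_ssubset {A : Matrix (Fin n) (Fin n) ℝ} {b : Fin n → ℝ} {τ : ℝ}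
    (hopt : ∃ z, IsOptimal A b τ z) {x y : Fin n → ℝ} (h : F A b τ y < FStar A b τ x) :
    reachable A b τ y ⊂ reachable A b τ x := by
  refine Finset.ssubset_iff_subset_ne.2
    ⟨reachable_mono (h.le.trans (FStar_le hopt (self_mem_coordSubspace x))), fun he => ?_⟩
  have hx : IZero x ∈ reachable A b τ x := by
    refine mem_reachable.2 ⟨?_, x, self_mem_coordSubspace x, le_rfl⟩
    rintro ⟨z, hz, hsub⟩
    refine absurd (hz y) (not_le.2 (h.trans_le (FStar_le hopt fun j hj => ?_)))
    simpa [IZero] using hsub hj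
  rw [← he] at hx
  obtain ⟨-, z, hz, hF⟩ := mem_reachable.1 hx
  exact absurd hF (not_le.2 (h.trans_le (FStar_le hopt hz)))

theorem card_reachable_lt_Lnum (A : Matrix (Fin n) (Fin n) ℝ) (b : Fin n → ℝ) (τ : ℝ)
    (x : Fin n → ℝ) : (reachable A b τ x).card < Lnum A b τ := by
  -- Boundedness is needed because `sSup` of an unbounded set of naturals is 0; distinct subsets
  -- number at most 2^n.
  refine Nat.lt_succ_of_le (le_csSup ⟨Fintype.card (Finset (Fin n)), ?_⟩ ?_)
  · rintro ℓ ⟨C, hC, -⟩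
    simpa using Fintype.card_le_of_injective C hC
  · refine ⟨fun i => ((reachable A b τ x).equivFin.symm i).1,
      Subtype.val_injective.comp (Equiv.injective _), fun i => ?_⟩
    exact (mem_reachable.1 ((reachable A b τ x).equivFin.symm i).2).1

theorem gcg2_loopReturns {A : Matrix (Fin n) (Fin n) ℝ} (hA : A.PosSemidef)
    {b : Fin n → ℝ} {τ : ℝ} (hτ : 0 ≤ τ) (hopt : ∃ z, IsOptimal A b τ z)
    {x0 : Fin n → ℝ} {η : ℝ} (hη : 0 < η) (herr : ErrorBound A b τ x0 η)
    {ε : ℝ} (hε : 0 ≤ ε) (m : ℕ) :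
    ∀ x, F A b τ x ≤ F A b τ x0 → (reachable A b τ x).card ≤ m →
    ∃ k ≤ 2 * m + 2, ∃ y, LoopReturns (gcg2Step A b τ η ε) k x y := by
  induction m using Nat.strong_induction_on with
  | _ m ih =>
  -- At a point where TPCG2 is not called, one pass fewer suffices: a line search costs one pass and
  -- lowers the count below m, and 1 + (2(m - 1) + 2) = 2m + 1. A TPCG2 call always leads to such a
  -- point.
  have main : ∀ x, F A b τ x ≤ F A b τ x0 → (reachable A b τ x).card ≤ m →
      (‖v A b τ x‖ ≤ ε ∨
        subNorm (IZero x) (v A b τ x) > √η * subNorm (INonzero x) (v A b τ x)) →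
      ∃ k ≤ 2 * m + 1, ∃ y, LoopReturns (gcg2Step A b τ η ε) k x y := by
    intro x hx hcard hor
    by_cases hret : ‖v A b τ x‖ ≤ ε
    · exact ⟨1, by omega, x, Or.inl (by simp [gcg2Step, if_pos hret])⟩
    have hls := hor.resolve_left hret
    obtain ⟨hne, hlt⟩ := lineSearch_spec hA hτ hopt hη (herr x hx) hls
    have hc := (Finset.card_lt_card (reachable_ssubset hopt hlt)).trans_le hcard
    obtain ⟨k, hk, y, hy⟩ := ih (m - 1) (by omega) _
      ((hlt.le.trans (FStar_le hopt (self_mem_coordSubspace x))).trans hx) (by omega)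
    refine ⟨k + 1, by omega, y, Or.inr ⟨_, ?_, hy⟩⟩
    rw [gcg2Step, if_neg hret, if_pos hls, Part.assert_pos hne]
    exact Part.mem_some _
  intro x hx hcard
  by_cases hor : ‖v A b τ x‖ ≤ ε ∨
      subNorm (IZero x) (v A b τ x) > √η * subNorm (INonzero x) (v A b τ x)
  · obtain ⟨k, hk, hy⟩ := main x hx hcard hor
    exact ⟨k, by omega, hy⟩
  obtain ⟨hret, hls⟩ := not_or.1 hor
  have hm1 : 1 ≤ max (√(n * η)) 1 := le_max_right _ _
  -- The inner tolerance is at most ε, so a violated outer test is also violated at the inner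
  -- tolerance.
  obtain ⟨x', hx', hF, hv⟩ := tpcg2_spec hA hτ hopt
    (div_nonneg hε (zero_le_one.trans hm1)) (x := x)
    fun h => hret (h.trans (div_le_self hε hm1))
  obtain ⟨k, hk, y, hy⟩ := main x' (hF.trans hx)
    ((Finset.card_le_card (reachable_mono hF)).trans hcard) (norm_v_le_or_lineSearch hε hv)
  refine ⟨k + 1, by omega, y, Or.inr ⟨x', ?_, hy⟩⟩
  rw [gcg2Step, if_neg hret, if_neg hls]
  exact (Part.mem_map_iff _).2 ⟨x', hx', rfl⟩

end L1QP

end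

theorem mainTheorem2 (n : ℕ) (A : Matrix (Fin n) (Fin n) ℝ) (hA : A.PosSemidef)
    (b : Fin n → ℝ) (τ : ℝ) (hτ : 0 ≤ τ) (hopt : ∃ z, L1QP.IsOptimal A b τ z)
    (x0 : Fin n → ℝ) (η : ℝ) (hη : 0 < η) (herr : L1QP.ErrorBound A b τ x0 η)
    (ε : ℝ) (hε : 0 ≤ ε) :
    (∃ k ≤ 2 * L1QP.Lnum A b τ, ∃ y,
      L1QP.LoopReturns (L1QP.gcg2Step A b τ η ε) k x0 y) ∧
    (∀ y ∈ L1QP.gcg2 A b τ x0 η ε,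
      (∃ s ∈ L1QP.subdiff A b τ y, ‖s‖ ≤ ε) ∧ (ε = 0 → L1QP.IsOptimal A b τ y)) := by
  constructor
  · obtain ⟨k, hk, h⟩ := L1QP.gcg2_loopReturns hA hτ hopt hη herr hε _ x0 le_rfl le_rfl
    -- The strict inequality absorbs the constant: m + 1 ≤ L(n) gives 2m + 2 ≤ 2L(n).
    have := L1QP.card_reachable_lt_Lnum A b τ x0
    exact ⟨k, by omega, h⟩
  · intro y hy
    have hv := L1QP.norm_v_le_of_mem_gcg2 hy
    have hs := L1QP.v_mem_subdiff hA b hτ y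
    refine ⟨⟨_, hs, hv⟩, fun h0 => L1QP.isOptimal_of_zero_mem_subdiff ?_⟩
    rwa [norm_le_zero_iff.1 (hv.trans_eq h0)] at hs
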